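/- Let $\varphi:\mathbb{R}\to\mathbb{R}$ be a continuous function which is not a polynomial and satisfies $|\varphi(x)|\le C_1|x|^\alpha+C_2$ for all $x\in\mathbb{R}$, for some constants $\alpha,C_1,C_2\ge 0$. Let $\mu$ be a probability distribution on $\mathbb{R}$ with full support such that $\int|x|^\alpha\,d\mu(x)<\infty$. Then for every $d\in\mathbb{N}$ the pair $(\varphi,\mu^{d+1})$ is universal, where $\mu^{d+1}$ is the $(d+1)$-fold product measure of $\mu$ on $\mathbb{R}^{d+1}$. Here a pair $(\varphi,\nu)$, with $\nu$ a probability distribution on $\mathbb{R}^{d+1}$, is called universal if, for a sequence $(w_i^\intercal,b_i)_{i\ge 1}$ of i.i.d. random vectors with distribution $\nu$ (where $w_i\in\mathbb{R}^d$, $b_i\in\mathbb{R}$), the following holds: for every compact set $\mathcal{X}\subseteq\mathbb{R}^d$, every $f\in C(\mathcal{X})$ and all $\epsilon,\delta\in(0,1)$, there is an integer $n\ge 1$ such that, with probability at least $1-\delta$, there exist $a_1,\dots,a_n\in\mathbb{R}$ (which may depend on the random vectors) with $$\sup_{x\in\mathcal{X}}\Big|f(x)-\sum_{i=1}^n a_i\,\varphi(w_i\cdot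 x+b_i)\Big|\le\epsilon .$$ -/

import Mathlib

open MeasureTheory ProbabilityTheory

universe u

/-- The output `φ (w · x + b)` of a neuron at the input `x ∈ ℝ^d`, where the parameter
`θ = (wᵀ, b) ∈ ℝ^(d+1)` consists of the weight `w` (the first `d` coordinates) and the
bias `b` (the last coordinate). -/
noncomputable def neuron {d : ℕ} (φ : ℝ → ℝ) (θ : Fin (d + 1) → ℝ) (x : Fin d → ℝ) : ℝ :=
  φ ((∑ j : Fin d, θ j.castSucc * x j) + θ (Fin.last d))

/-- The pair `(φ, μ)`, with `φ : ℝ → ℝ` and `μ` a probability distribution on `ℝ^(d+1)`, is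
universal: for every i.i.d. sequence `θ 0, θ 1, …` of random vectors with law `μ`, every compact
`K ⊆ ℝ^d`, every `f ∈ C(K)` and all `ε, δ ∈ (0, 1)` there is a number `n ≥ 1` of neurons such that,
on an event of probability at least `1 - δ`, some linear combination of the first `n` random
neurons (with coefficients that may depend on the outcome) approximates `f` on `K` uniformly
with error at most `ε`. -/
def IsUniversalPair {d : ℕ} (φ : ℝ → ℝ) (μ : Measure (Fin (d + 1) → ℝ)) : Prop :=
  ∀ (Ω : Type u) [MeasurableSpace Ω] (P : Measure Ω) [IsProbabilityMeasure P]
    (θ : ℕ → Ω → (Fin (d + 1) → ℝ)),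
    iIndepFun θ P → (∀ i, HasLaw (θ i) μ P) →
    ∀ K : Set (Fin d → ℝ), IsCompact K → ∀ f : C(K, ℝ),
    ∀ ε ∈ Set.Ioo (0 : ℝ) 1, ∀ δ ∈ Set.Ioo (0 : ℝ) 1,
    ∃ n : ℕ, 1 ≤ n ∧ ∃ A : Set Ω, MeasurableSet A ∧ 1 - δ ≤ P.real A ∧
      ∀ ω ∈ A, ∃ a : Fin n → ℝ, ∀ x : K,
        |f x - ∑ i : Fin n, a i * neuron φ (θ i ω) x| ≤ ε

open Filter Topology Set

/-! Let `V` be the closed span of all neurons in `C(K, ℝ)` and `l` a linear form. If `φ` were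
smooth, differentiating `φ (t * l + b)` `k` times at `t = 0` would put `φ⁽ᵏ⁾(b) • l ^ k` in `V`. In
general this applies to mollifications of `φ`; were `l ^ k ∉ V`, they would all be polynomials of
degree `< k`, and so would their limit `φ`. Hence `V` contains every `l ^ k`, so every `exp l`, and
Stone–Weierstrass gives `V = ⊤`. An approximant uses finitely many neurons and survives small
changes of their parameters. Full support gives each such neighbourhood positive mass, so many
independent samples hit them all with high probability. -/

/-- The linear combinations of `1, x, …, x ^ (k - 1)` are closed under pointwise limits. -/
theorem exists_sum_pow_of_tendsto {k : ℕ} {g : ℕ → ℝ → ℝ} {φ : ℝ → ℝ}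
    (hg : ∀ n, ∃ c : Fin k → ℝ, ∀ x, g n x = ∑ i, c i * x ^ (i : ℕ))
    (hlim : ∀ x, Tendsto (fun n => g n x) atTop (𝓝 (φ x))) :
    ∃ c : Fin k → ℝ, ∀ x, φ x = ∑ i, c i * x ^ (i : ℕ) := by
  let L : (Fin k → ℝ) →ₗ[ℝ] (ℝ → ℝ) :=
    Fintype.linearCombination ℝ (fun (i : Fin k) (x : ℝ) => x ^ (i : ℕ))
  have hL : ∀ c x, L c x = ∑ i, c i * x ^ (i : ℕ) := fun c x => by
    simp [L, Fintype.linearCombination_apply]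
  have hclosed : IsClosed (LinearMap.range L : Set (ℝ → ℝ)) :=
    Submodule.closed_of_finiteDimensional _
  obtain ⟨c, hc⟩ : φ ∈ LinearMap.range L := by
    refine hclosed.mem_of_tendsto (tendsto_pi_nhds.2 hlim) (Eventually.of_forall fun n => ?_)
    obtain ⟨c, hc⟩ := hg n
    exact ⟨c, funext fun x => by rw [hL, hc]⟩
  exact ⟨c, fun x => by rw [← hL, hc]⟩

theorem exists_sum_pow_of_iteratedDeriv_eq_zero (k : ℕ) {g : ℝ → ℝ}
    (hg : ContDiff ℝ k g) (h : ∀ x, iteratedDeriv k g x = 0) :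
    ∃ c : Fin k → ℝ, ∀ x, g x = ∑ i, c i * x ^ (i : ℕ) := by
  induction k generalizing g with
  | zero => exact ⟨fun _ => 0, fun x => by simpa using h x⟩
  | succ k ih =>
    have hd : Differentiable ℝ g := hg.differentiable (by simp)
    have hg' : ContDiff ℝ k (deriv g) := by
      have : ContDiff ℝ ((k : WithTop ℕ∞) + 1) g := by exact_mod_cast hg
      exact (contDiff_succ_iff_deriv.1 this).2.2
    obtain ⟨c, hc⟩ := ih hg' (fun x => by rw [← iteratedDeriv_succ']; exact h x)
    refine ⟨Fin.cons (g 0) (fun i => c i / ((i : ℝ) + 1)), fun x => ?_⟩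
    let q : ℝ → ℝ := fun x => ∑ i : Fin k, c i / ((i : ℝ) + 1) * x ^ ((i : ℕ) + 1)
    have hq : ∀ x, HasDerivAt q (deriv g x) x := fun x => by
      rw [hc]
      refine HasDerivAt.fun_sum fun i _ => ?_
      convert! (hasDerivAt_pow ((i : ℕ) + 1) x).const_mul (c i / ((i : ℝ) + 1)) using 1
      have : (i : ℝ) + 1 ≠ 0 := by positivity
      push_cast
      field_simp
    have hconst := is_const_of_deriv_eq_zero (f := fun x => g x - q x)
      (fun x => (hd x).sub (hq x).differentiableAt)
      (fun x => ((hd x).hasDerivAt.sub (hq x)).deriv.trans (sub_self _)) x 0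
    have hq0 : q 0 = 0 := by simp [q]
    simp only [hq0, sub_zero] at hconst
    rw [Fin.sum_univ_succ]
    simp only [Fin.cons_zero, Fin.cons_succ, Fin.val_zero, pow_zero, mul_one, Fin.val_succ]
    change g x = g 0 + q x
    linarith

/-! ### Closed subspaces under integrals and derivatives -/

section ClosedSubspace

variable {E : Type*} [NormedAddCommGroup E] [NormedSpace ℝ E]

/-- The quotient map by `V` is continuous, so it commutes with the integral, and it kills the
integrand. -/
theorem Submodule.integral_mem_of_isClosed [CompleteSpace E] {T : Type*} [MeasurableSpace T] {ν : Measure T}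
    (V : Submodule ℝ E) (hV : IsClosed (V : Set E)) {F : T → E} (hF : ∀ t, F t ∈ V)
    (hint : Integrable F ν) : ∫ t, F t ∂ν ∈ V := by
  have : IsClosed (V : Set E) := hV
  have h : V.mkQL (∫ t, F t ∂ν) = 0 := by
    rw [← ContinuousLinearMap.integral_comp_comm _ hint]
    have : ∀ t, V.mkQL (F t) = 0 := fun t => (Submodule.Quotient.mk_eq_zero V).2 (hF t)
    simp [this]
  exact (Submodule.Quotient.mk_eq_zero V).1 h

theorem Submodule.hasDerivAt_mem_of_isClosed (V : Submodule ℝ E) (hV : IsClosed (V : Set E))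
    {F : ℝ → E} (hF : ∀ t, F t ∈ V) {F' : E} {t : ℝ} (h : HasDerivAt F F' t) : F' ∈ V := by
  refine hV.mem_of_tendsto (hasDerivAt_iff_tendsto_slope.1 h) (Eventually.of_forall fun s => ?_)
  exact V.smul_mem _ (V.sub_mem (hF s) (hF t))

end ClosedSubspace

/-! ### Ridge functions and density -/

section Ridge

variable {X : Type*} [TopologicalSpace X]

/-- The continuous function `x ↦ g (t * l x + b)`. -/
def ridge (l : C(X, ℝ)) (g : C(ℝ, ℝ)) (t b : ℝ) : C(X, ℝ) where
  toFun x := g (t * l x + b)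

theorem continuous_ridge (l : C(X, ℝ)) (g : C(ℝ, ℝ)) :
    Continuous fun p : ℝ × ℝ => ridge l g p.1 p.2 :=
  ContinuousMap.continuous_of_continuous_uncurry _
    (by simp only [Function.uncurry_def, ridge, ContinuousMap.coe_mk]; fun_prop)

variable [CompactSpace X]

/-- The derivative is in sup norm, not just pointwise: the pointwise fundamental theorem of calculus
becomes an identity of `C(X, ℝ)`-valued integrals with continuous integrand. -/
theorem hasDerivAt_ridge (l : C(X, ℝ)) {g g' : C(ℝ, ℝ)} (hg : ∀ s, HasDerivAt g (g' s) s)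
    (t b : ℝ) : HasDerivAt (fun t => ridge l g t b) (l * ridge l g' t b) t := by
  have hcont : Continuous fun t => l * ridge l g' t b :=
    continuous_const.mul ((continuous_ridge l g').comp (by fun_prop : Continuous fun t => (t, b)))
  have hint : ∀ t, ridge l g t b = ridge l g 0 b + ∫ s in (0 : ℝ)..t, l * ridge l g' s b := by
    intro t
    ext x
    have h1 : (∫ s in (0 : ℝ)..t, l * ridge l g' s b) x
        = ∫ s in (0 : ℝ)..t, l x * g' (s * l x + b) := by
      have := ContinuousLinearMap.intervalIntegral_comp_comm (ContinuousMap.evalCLM ℝ x)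
        (hcont.intervalIntegrable (μ := volume) 0 t)
      exact this.symm
    have h2 : ∫ s in (0 : ℝ)..t, l x * g' (s * l x + b) = g (t * l x + b) - g (0 * l x + b) := by
      refine intervalIntegral.integral_eq_sub_of_hasDerivAt (f := fun s => g (s * l x + b))
        (fun s _ => ?_) ?_
      · have := (hg (s * l x + b)).comp s (((hasDerivAt_id s).mul_const (l x)).add_const b)
        simpa [mul_comm, Function.comp_def] using this
      · exact Continuous.intervalIntegrable (by fun_prop) _ _
    rw [ContinuousMap.add_apply, h1, h2]
    simp [ridge]
  rw [funext hint]
  exact (intervalIntegral.integral_hasDerivAt_right (hcont.intervalIntegrable _ _)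
    hcont.aestronglyMeasurable.stronglyMeasurableAtFilter hcont.continuousAt).const_add _

open scoped ContDiff in
theorem iteratedDeriv_smul_pow_mem (V : Submodule ℝ C(X, ℝ)) (hV : IsClosed (V : Set C(X, ℝ)))
    (l : C(X, ℝ)) (g : C(ℝ, ℝ)) (hg : ContDiff ℝ ∞ g) (hmem : ∀ t b, ridge l g t b ∈ V)
    (k : ℕ) (b : ℝ) : iteratedDeriv k g b • l ^ k ∈ V := by
  have hc : ∀ k : ℕ, Continuous (iteratedDeriv k g) := fun k =>
    hg.continuous_iteratedDeriv k (by exact_mod_cast le_top)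
  -- Each derivative in `t` brings out one factor `l`; at `t = 0` the ridge function is the constant
  -- `iteratedDeriv k g b`.
  have key : ∀ (k : ℕ) (t b : ℝ), l ^ k * ridge l ⟨iteratedDeriv k g, hc k⟩ t b ∈ V := by
    intro k
    induction k with
    | zero =>
      intro t b
      convert hmem t b using 1
      ext x
      simp [ridge]
    | succ k ih =>
      intro t b
      have hd := (hasDerivAt_ridge l (g := ⟨iteratedDeriv k g, hc k⟩)
        (g' := ⟨iteratedDeriv (k + 1) g, hc (k + 1)⟩) (fun s => by
          simp only [ContinuousMap.coe_mk, iteratedDeriv_succ]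
          exact ((hg.differentiable_iteratedDeriv k (by exact_mod_cast ENat.natCast_lt_top k)) s).hasDerivAt) t b).const_mul (l ^ k)
      rw [pow_succ, mul_assoc]
      exact V.hasDerivAt_mem_of_isClosed hV (fun t => ih t b) hd
  convert key k 0 b using 1
  ext x
  simp [ridge, mul_comm]

open scoped Convolution ContDiff in
theorem pow_mem_of_not_polynomial (V : Submodule ℝ C(X, ℝ)) (hV : IsClosed (V : Set C(X, ℝ)))
    (l : C(X, ℝ)) (φ : C(ℝ, ℝ)) (hpoly : ¬ ∃ p : Polynomial ℝ, ∀ x : ℝ, φ x = p.eval x)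
    (hmem : ∀ t b, ridge l φ t b ∈ V) (k : ℕ) : l ^ k ∈ V := by
  by_contra hk
  let ψ : ℕ → ContDiffBump (0 : ℝ) := fun n =>
    ⟨1 / ((n : ℝ) + 1) / 2, 1 / ((n : ℝ) + 1), by positivity, half_lt_self (by positivity)⟩
  let G : ℕ → ℝ → ℝ := fun n =>
    (ψ n).normed volume ⋆[ContinuousLinearMap.lsmul ℝ ℝ, volume] φ
  have hG : ∀ n, ContDiff ℝ ∞ (G n) := fun n =>
    (ψ n).hasCompactSupport_normed.contDiff_convolution_left _ (ψ n).contDiff_normed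
      φ.continuous.locallyIntegrable
  -- Mollifying `φ` averages ridge functions over shifts of the bias.
  have hGmem : ∀ n t b, ridge l ⟨G n, (hG n).continuous⟩ t b ∈ V := by
    intro n t b
    let F : ℝ → C(X, ℝ) := fun y => (ψ n).normed volume y • ridge l φ t (b - y)
    have hFc : Continuous F := (ψ n).continuous_normed.smul
      ((continuous_ridge l φ).comp (by fun_prop : Continuous fun y => (t, b - y)))
    have hFi : Integrable F := hFc.integrable_of_hasCompactSupport
      (ψ n).hasCompactSupport_normed.smul_right
    have : ridge l ⟨G n, (hG n).continuous⟩ t b = ∫ y, F y := by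
      ext x
      rw [ContinuousMap.integral_apply hFi]
      simp [ridge, G, F, convolution_def, add_sub_assoc]
    rw [this]
    exact V.integral_mem_of_isClosed hV (fun y => V.smul_mem _ (hmem _ _)) hFi
  have hzero : ∀ n x, iteratedDeriv k (G n) x = 0 := by
    intro n x
    by_contra hne
    exact hk ((V.smul_mem_iff hne).1
      (iteratedDeriv_smul_pow_mem V hV l ⟨G n, (hG n).continuous⟩ (hG n) (hGmem n) k x))
  have hlim : ∀ x, Tendsto (fun n => G n x) atTop (𝓝 (φ x)) := fun x =>
    ContDiffBump.convolution_tendsto_right_of_continuous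
      tendsto_one_div_add_atTop_nhds_zero_nat φ.continuous x
  obtain ⟨c, hc⟩ := exists_sum_pow_of_tendsto
    (fun n => exists_sum_pow_of_iteratedDeriv_eq_zero k ((hG n).of_le (by exact_mod_cast le_top)) (hzero n)) hlim
  refine hpoly ⟨∑ i, Polynomial.C (c i) * Polynomial.X ^ (i : ℕ), fun x => ?_⟩
  rw [hc]
  simp [Polynomial.eval_finsetSum]

theorem exp_mem_of_pow_mem (V : Submodule ℝ C(X, ℝ)) (hV : IsClosed (V : Set C(X, ℝ)))
    (l : C(X, ℝ)) (h : ∀ k : ℕ, l ^ k ∈ V) : NormedSpace.exp l ∈ V := by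
  refine hV.mem_of_tendsto (NormedSpace.exp_series_hasSum_exp' (𝕂 := ℝ) l)
    (Eventually.of_forall fun s => ?_)
  exact V.sum_mem fun i _ => V.smul_mem _ (h i)

/-- `V` need not be an algebra: since `exp` turns sums into products, the linear span of the
exponentials already is one, and it lies in `V`. -/
theorem eq_top_of_exp_mem (V : Submodule ℝ C(X, ℝ)) (hV : IsClosed (V : Set C(X, ℝ)))
    (S : AddSubmonoid C(X, ℝ)) (hS : ∀ x y : X, x ≠ y → ∃ l ∈ S, l x ≠ l y)
    (h : ∀ l ∈ S, NormedSpace.exp l ∈ V) : V = ⊤ := by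
  let M : Submonoid C(X, ℝ) :=
    { carrier := NormedSpace.exp '' (S : Set C(X, ℝ))
      one_mem' := ⟨0, S.zero_mem, NormedSpace.exp_zero⟩
      mul_mem' := by
        rintro _ _ ⟨a, ha, rfl⟩ ⟨b, hb, rfl⟩
        exact ⟨a + b, S.add_mem ha hb, NormedSpace.exp_add⟩ }
  let A : Subalgebra ℝ C(X, ℝ) := Algebra.adjoin ℝ (M : Set C(X, ℝ))
  have hAV : Subalgebra.toSubmodule A ≤ V := by
    rw [Algebra.adjoin_eq_span, Submonoid.closure_eq, Submodule.span_le]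
    rintro _ ⟨l, hl, rfl⟩
    exact h l hl
  have hexp : ∀ (l : C(X, ℝ)) (x : X), NormedSpace.exp l x = Real.exp (l x) := by
    intro l x
    rw [Real.exp_eq_exp_ℝ]
    exact NormedSpace.map_exp (ContinuousMap.evalAlgHom ℝ ℝ x) (ContinuousMap.evalCLM ℝ x).continuous l
  have hsep : A.SeparatesPoints := by
    intro x y hxy
    obtain ⟨l, hl, hne⟩ := hS x y hxy
    refine ⟨_, ⟨NormedSpace.exp l, Algebra.subset_adjoin ⟨l, hl, rfl⟩, rfl⟩, ?_⟩
    change NormedSpace.exp l x ≠ NormedSpace.exp l y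
    rw [hexp, hexp]
    exact fun he => hne (Real.exp_injective he)
  have htop := ContinuousMap.subalgebra_topologicalClosure_eq_top_of_separatesPoints A hsep
  refine eq_top_iff.2 fun f _ => ?_
  have hf : f ∈ A.topologicalClosure := htop ▸ Algebra.mem_top
  exact closure_minimal hAV hV hf

end Ridge

/-- The neuron with parameter `θ`, as a continuous function on `K`. -/
noncomputable def neuronMap {d : ℕ} (K : Set (Fin d → ℝ)) (φ : C(ℝ, ℝ)) (θ : Fin (d + 1) → ℝ) :
    C(K, ℝ) where
  toFun x := neuron φ θ x
  continuous_toFun := by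
    refine φ.continuous.comp (.add (continuous_finsetSum _ fun j _ => ?_) continuous_const)
    exact continuous_const.mul ((continuous_apply j).comp continuous_subtype_val)

theorem continuous_neuronMap {d : ℕ} (K : Set (Fin d → ℝ)) (φ : C(ℝ, ℝ)) :
    Continuous (neuronMap K φ) :=
  ContinuousMap.continuous_of_continuous_uncurry _ <| by
    refine φ.continuous.comp (.add (continuous_finsetSum _ fun j _ => ?_)
      ((continuous_apply (Fin.last d)).comp continuous_fst))
    exact ((continuous_apply j.castSucc).comp continuous_fst).mul
      ((continuous_apply j).comp (continuous_subtype_val.comp continuous_snd))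

/-- Universal approximation: the neurons with a continuous non-polynomial activation function span
a dense subspace of `C(K, ℝ)`. -/
theorem topologicalClosure_span_neuronMap {d : ℕ} (K : Set (Fin d → ℝ)) [CompactSpace K]
    (φ : C(ℝ, ℝ)) (hpoly : ¬ ∃ p : Polynomial ℝ, ∀ x : ℝ, φ x = p.eval x) :
    (Submodule.span ℝ (range (neuronMap K φ))).topologicalClosure = ⊤ := by
  set V := (Submodule.span ℝ (range (neuronMap K φ))).topologicalClosure with hVdef
  have hV : IsClosed (V : Set C(K, ℝ)) := Submodule.isClosed_topologicalClosure _
  let L : (Fin d → ℝ) →+ C(K, ℝ) :=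
    { toFun := fun w => ⟨fun x => ∑ j, w j * (x : Fin d → ℝ) j,
        continuous_finsetSum _ fun j _ =>
          continuous_const.mul ((continuous_apply j).comp continuous_subtype_val)⟩
      map_zero' := by ext x; simp
      map_add' := fun v w => by ext x; simp [add_mul, Finset.sum_add_distrib] }
  refine eq_top_of_exp_mem V hV (AddMonoidHom.mrange L) ?_ ?_
  · intro x y hxy
    obtain ⟨j, hj⟩ := Function.ne_iff.1 (fun h => hxy (Subtype.ext h))
    exact ⟨_, ⟨Pi.single j 1, rfl⟩, by simpa [L, Pi.single_apply] using hj⟩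
  · rintro _ ⟨w, rfl⟩
    refine exp_mem_of_pow_mem V hV _ (pow_mem_of_not_polynomial V hV _ φ hpoly fun t b => ?_)
    refine Submodule.le_topologicalClosure _ (Submodule.subset_span ⟨Fin.snoc (t • w) b, ?_⟩)
    ext x
    simp [neuronMap, neuron, ridge, L, Finset.mul_sum, mul_assoc]

/-! ### Random sampling -/

/-- If `f` is in the closed span of a family `N`, then there are finitely many members of `N` such
that `f` is approximated by combinations of any list that comes close to each of them. -/
theorem exists_radius_of_mem_span {T E : Type*} [NormedAddCommGroup E] [NormedSpace ℝ E]
    {N : T → E} {f : E}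
    (hf : f ∈ (Submodule.span ℝ (range N)).topologicalClosure) {ε : ℝ} (hε : 0 < ε) :
    ∃ (s : Finset T) (r : ℝ), 0 < r ∧ ∀ (n : ℕ) (θ : Fin n → T),
      (∀ η ∈ s, ∃ i, ‖N (θ i) - N η‖ < r) → ∃ a : Fin n → ℝ, ‖f - ∑ i, a i • N (θ i)‖ ≤ ε := by
  classical
  obtain ⟨g, hg, hfg⟩ := Metric.mem_closure_iff.1 hf (ε / 2) (half_pos hε)
  obtain ⟨c, rfl⟩ := Finsupp.mem_span_range_iff_exists_finsupp.1 hg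
  set S := ∑ η ∈ c.support, |c η| with hS
  have hS0 : 0 ≤ S := Finset.sum_nonneg fun _ _ => abs_nonneg _
  refine ⟨c.support, ε / 2 / (S + 1), by positivity, fun n θ hθ => ?_⟩
  choose σ hσ using hθ
  -- One sample may serve several `η`; its coefficient is the sum of theirs.
  refine ⟨fun i => ∑ η ∈ c.support.attach with σ η.1 η.2 = i, c η, ?_⟩
  have hsum : ∑ i, (∑ η ∈ c.support.attach with σ η.1 η.2 = i, c η) • N (θ i)
      = ∑ η ∈ c.support.attach, c η • N (θ (σ η.1 η.2)) := by
    rw [← Finset.sum_fiberwise c.support.attach (fun η => σ η.1 η.2)]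
    refine Finset.sum_congr rfl fun i _ => ?_
    rw [Finset.sum_smul]
    refine Finset.sum_congr rfl fun η hη => ?_
    rw [(Finset.mem_filter.1 hη).2]
  have hdiff : ‖(c.sum fun η a => a • N η) - ∑ η ∈ c.support.attach, c η • N (θ (σ η.1 η.2))‖
      ≤ ε / 2 := by
    rw [Finsupp.sum, ← Finset.sum_attach, ← Finset.sum_sub_distrib]
    calc _ ≤ ∑ η ∈ c.support.attach, |c η| * (ε / 2 / (S + 1)) := by
          refine norm_sum_le_of_le _ fun η _ => ?_
          rw [← smul_sub, norm_smul, Real.norm_eq_abs, norm_sub_rev]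
          exact mul_le_mul_of_nonneg_left (hσ η.1 η.2).le (abs_nonneg _)
      _ = S * (ε / 2 / (S + 1)) := by
          rw [← Finset.sum_mul, Finset.sum_attach c.support (fun η => |c η|)]
      _ ≤ ε / 2 := by
          rw [mul_div_assoc', div_le_iff₀ (by positivity)]
          nlinarith
  rw [hsum]
  rw [dist_eq_norm] at hfg
  calc _ ≤ _ := norm_sub_le_norm_sub_add_norm_sub _ _ _
    _ ≤ ε / 2 + ε / 2 := add_le_add hfg.le hdiff
    _ = ε := add_halves ε

/-- With high probability the first terms of an i.i.d. sequence hit each of finitely many sets of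
positive measure. -/
theorem exists_forall_mem_of_iIndepFun {Ω T ι : Type*} [MeasurableSpace Ω] [MeasurableSpace T]
    {P : Measure Ω} [IsProbabilityMeasure P] {ν : Measure T} [IsProbabilityMeasure ν]
    {θ : ℕ → Ω → T} (hind : iIndepFun θ P) (hlaw : ∀ i, HasLaw (θ i) ν P)
    (s : Finset ι) {U : ι → Set T} (hU : ∀ j, MeasurableSet (U j)) (hpos : ∀ j ∈ s, 0 < ν (U j))
    {δ : ℝ} (hδ : 0 < δ) :
    ∃ n : ℕ, 1 ≤ n ∧ ∃ A : Set Ω, MeasurableSet A ∧ 1 - δ ≤ P.real A ∧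
      ∀ ω ∈ A, ∀ j ∈ s, ∃ i : Fin n, θ i ω ∈ U j := by
  have hmiss : ∀ j n, P.real (⋂ i ∈ Finset.range n, θ i ⁻¹' (U j)ᶜ) = (1 - ν.real (U j)) ^ n := by
    intro j n
    rw [measureReal_def, hind.measure_inter_preimage_eq_mul (Finset.range n)
      (sets := fun _ => (U j)ᶜ) (fun _ _ => (hU j).compl)]
    have : ∀ i, P (θ i ⁻¹' (U j)ᶜ) = ν (U j)ᶜ := fun i => by
      rw [← (hlaw i).map_eq, Measure.map_apply_of_aemeasurable (hlaw i).aemeasurable (hU j).compl]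
    rw [Finset.prod_congr rfl fun i _ => this i, ← probReal_compl_eq_one_sub (hU j)]
    simp [measureReal_def]
  have hlim : Tendsto (fun n => ∑ j ∈ s, (1 - ν.real (U j)) ^ n) atTop (𝓝 0) := by
    rw [← Finset.sum_const_zero (s := s)]
    refine tendsto_finsetSum _ fun j hj => ?_
    refine tendsto_pow_atTop_nhds_zero_of_lt_one (sub_nonneg.2 measureReal_le_one) ?_
    exact sub_lt_self _ (ENNReal.toReal_pos (hpos j hj).ne' (measure_ne_top _ _))
  obtain ⟨n, hn, hn1⟩ := ((hlim.eventually (gt_mem_nhds hδ)).and (eventually_ge_atTop 1)).exists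
  set B : Set Ω := ⋃ j ∈ s, ⋂ i ∈ Finset.range n, θ i ⁻¹' (U j)ᶜ with hB
  -- The `θ i` are only a.e. measurable, so `A` will be a measurable subset of `Bᶜ` of the same
  -- measure.
  have hBm : NullMeasurableSet B P := by
    refine Finset.nullMeasurableSet_biUnion s fun j _ =>
      Finset.nullMeasurableSet_biInter _ fun i _ => ?_
    exact (hlaw i).aemeasurable.nullMeasurableSet_preimage (hU j).compl
  have hBle : P.real B ≤ δ := (measureReal_biUnion_finset_le _ _).trans
    (by simpa only [hmiss] using hn.le)
  obtain ⟨A, hAB, hA, hae⟩ := hBm.compl.exists_measurable_subset_ae_eq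
  refine ⟨n, hn1, A, hA, ?_, fun ω hω j hj => ?_⟩
  · rw [measureReal_congr hae, probReal_compl_eq_one_sub₀ hBm]
    linarith
  · have := hAB hω
    simp only [hB, mem_compl_iff, mem_iUnion, mem_iInter, not_exists, not_forall, Finset.mem_range,
      mem_preimage, not_not] at this
    obtain ⟨i, hi, hmem⟩ := this j hj
    exact ⟨⟨i, hi⟩, hmem⟩

theorem isOpenPosMeasure_of_support_eq_univ {T : Type*} [TopologicalSpace T] [MeasurableSpace T]
    {μ : Measure T} (h : μ.support = univ) : μ.IsOpenPosMeasure := by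
  refine ⟨fun U hU ⟨x, hx⟩ => ?_⟩
  have hxs : x ∈ μ.support := h ▸ mem_univ x
  exact ((Measure.mem_support_iff_forall x).1 hxs U (hU.mem_nhds hx)).ne'

theorem isUniversalPair_of_isOpenPosMeasure {d : ℕ} {φ : ℝ → ℝ} (hφ : Continuous φ)
    (hpoly : ¬ ∃ p : Polynomial ℝ, ∀ x : ℝ, φ x = p.eval x)
    (ν : Measure (Fin (d + 1) → ℝ)) [IsProbabilityMeasure ν] [ν.IsOpenPosMeasure] :
    IsUniversalPair.{u} φ ν := by
  intro Ω _ P _ θ hind hlaw K hK f ε hε δ hδ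
  have : CompactSpace K := isCompact_iff_compactSpace.1 hK
  have hf : f ∈ (Submodule.span ℝ (range (neuronMap K ⟨φ, hφ⟩))).topologicalClosure := by
    rw [topologicalClosure_span_neuronMap K ⟨φ, hφ⟩ hpoly]
    trivial
  obtain ⟨s, r, hr, hs⟩ := exists_radius_of_mem_span hf hε.1
  let U : (Fin (d + 1) → ℝ) → Set (Fin (d + 1) → ℝ) := fun η =>
    {ξ | ‖neuronMap K ⟨φ, hφ⟩ ξ - neuronMap K ⟨φ, hφ⟩ η‖ < r}
  have hU : ∀ η, IsOpen (U η) := fun η =>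
    isOpen_lt ((continuous_neuronMap K ⟨φ, hφ⟩).sub continuous_const).norm continuous_const
  obtain ⟨n, hn, A, hA, hPA, hhit⟩ := exists_forall_mem_of_iIndepFun hind hlaw s
    (fun η => (hU η).measurableSet) (fun η _ => (hU η).measure_pos ν ⟨η, by simpa [U] using hr⟩)
    hδ.1
  refine ⟨n, hn, A, hA, hPA, fun ω hω => ?_⟩
  obtain ⟨a, ha⟩ := hs n (fun i => θ i ω) (hhit ω hω)
  refine ⟨a, fun x => ?_⟩
  have := (ContinuousMap.norm_coe_le_norm _ x).trans ha
  simpa [neuronMap, ContinuousMap.sum_apply] using this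

theorem mainTheorem5 (φ : ℝ → ℝ) (hφ : Continuous φ)
    (hpoly : ¬ ∃ p : Polynomial ℝ, ∀ x : ℝ, φ x = p.eval x)
    (α C₁ C₂ : ℝ) (hα : 0 ≤ α) (hC₁ : 0 ≤ C₁) (hC₂ : 0 ≤ C₂)
    (hgrowth : ∀ x : ℝ, |φ x| ≤ C₁ * |x| ^ α + C₂)
    (μ : Measure ℝ) [IsProbabilityMeasure μ] (hsupp : μ.support = Set.univ)
    (hmoment : Integrable (fun x : ℝ => |x| ^ α) μ) (d : ℕ) :
    IsUniversalPair.{u} φ (Measure.pi (fun _ : Fin (d + 1) => μ)) := by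

  have := isOpenPosMeasure_of_support_eq_univ hsupp
  -- Nonempty open boxes have positive product measure, so full support passes from `μ` to its
  -- power.
  exact isUniversalPair_of_isOpenPosMeasure hφ hpoly _
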